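/- Let $F$ be a field of characteristic different from $2$, let $n \ge 0$ and let $A \in M_n(F)$. The following four statements are equivalent: 1. $A$ is a sum of two square-zero matrices, i.e. $A = S + T$ with $S, T \in M_n(F)$ and $S^2 = T^2 = 0$. 2. $A$ is similar to $-A$ over $F$. 3. There is an involution $V \in M_n(F)$, i.e. a matrix with $V^2 = I$, such that $AV = -VA$. 4. $A$ is similar over $F$ to a block diagonal matrix $\mathrm{Dg}[N, X, -X, C]$, where $N$ is a nilpotent square matrix, $X$ is an invertible square matrix, and $C$ is a square matrix similar to a block diagonal matrix each of whose diagonal blocks is the companion matrix $C(p(x)^e)$ of a power ($e \ge 1$) of a monic irreducible even polynomial $p(x) \in F[x]$ with nonzero constant term. Here any of the blocks $N$, $X$, $C$ may have size $0 \times 0$ (the blocks $X$ and $-X$ have equal size), a polynomial is called even if it has the form $q(x^2)$ with $q \in F[x]$, and the companion matrix of the monic polynomial $x^m + a_{m-1}x^{m-1} + \dots + a_0$ is the $m \times m$ matrix with ones on the subdiagonal, last column $(-a_0, \dots, -a_{m-1})^{T}$, and all other entries zero (for $m=1$ it is $(-a_0)$). -/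

import Mathlib

namespace SquareZeroSums

open Matrix Polynomial

/-- A square matrix is square-zero if its square is the zero matrix. -/
def IsSquareZero {F m : Type*} [Field F] [Fintype m] [DecidableEq m]
    (S : Matrix m m F) : Prop :=
  S ^ 2 = 0

/-- A square matrix `V` is an involution if `V ^ 2` is the identity matrix. -/
def IsInvolution {F m : Type*} [Field F] [Fintype m] [DecidableEq m]
    (V : Matrix m m F) : Prop :=
  V ^ 2 = 1

/-- Similarity of square matrices: `B = P⁻¹ A P` for an invertible `P`. The rows and columns of
`A` and `B` may be indexed by different types, so that `P` has rows indexed by `m`, columns indexed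
by `n`, and a two-sided inverse `Q`. See `isSimilar_iff` for the case `m = n`. -/
def IsSimilar {F m n : Type*} [Field F] [Fintype m] [DecidableEq m] [Fintype n] [DecidableEq n]
    (A : Matrix m m F) (B : Matrix n n F) : Prop :=
  ∃ (P : Matrix m n F) (Q : Matrix n m F), P * Q = 1 ∧ Q * P = 1 ∧ B = Q * A * P

theorem isSimilar_iff {F m : Type*} [Field F] [Fintype m] [DecidableEq m]
    (A B : Matrix m m F) :
    IsSimilar A B ↔ ∃ P : Matrix m m F, IsUnit P ∧ B = P⁻¹ * A * P := by
  constructor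
  · rintro ⟨P, Q, hPQ, hQP, h⟩
    refine ⟨P, ⟨⟨P, Q, hPQ, hQP⟩, rfl⟩, ?_⟩
    rw [Matrix.inv_eq_right_inv hPQ]
    exact h
  · rintro ⟨P, hP, h⟩
    have hd := (Matrix.isUnit_iff_isUnit_det P).1 hP
    exact ⟨P, P⁻¹, Matrix.mul_nonsing_inv P hd, Matrix.nonsing_inv_mul P hd, h⟩

/-- The block diagonal matrix with `A` in the upper left and `B` in the lower right block. -/
def dg {F m n : Type*} [Field F] (A : Matrix m m F) (B : Matrix n n F) :
    Matrix (m ⊕ n) (m ⊕ n) F :=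
  Matrix.fromBlocks A 0 0 B

/-- The companion matrix of a monic polynomial `p`: ones on the subdiagonal, the negatives
of the non-leading coefficients `a₀, a₁, …` of `p` in the last column, and zeros elsewhere. -/
def companion {F : Type*} [Field F] (p : F[X]) :
    Matrix (Fin p.natDegree) (Fin p.natDegree) F :=
  Matrix.of fun i j =>
    if (j : ℕ) + 1 = p.natDegree then -p.coeff i
    else if (i : ℕ) = (j : ℕ) + 1 then 1
    else 0

/-- An even(-power) polynomial: one of the form `q(x²)`. -/
def IsEvenPoly {F : Type*} [Field F] (p : F[X]) : Prop :=
  ∃ q : F[X], p = q.comp (X ^ 2)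

/-- `C` is similar to a block diagonal matrix (with possibly no blocks at all) whose diagonal
blocks are companion matrices of positive powers of monic irreducible even polynomials
with nonzero constant term. -/
def IsEvenPrimaryForm {F m : Type*} [Field F] [Fintype m] [DecidableEq m]
    (C : Matrix m m F) : Prop :=
  ∃ (t : ℕ) (p : Fin t → F[X]) (e : Fin t → ℕ),
    (∀ i, (p i).Monic ∧ Irreducible (p i) ∧ IsEvenPoly (p i) ∧ (p i).coeff 0 ≠ 0 ∧ 1 ≤ e i) ∧
    IsSimilar C (Matrix.blockDiagonal' fun i => companion (p i ^ e i))

end SquareZeroSums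

/-!
Everything reduces to the `F[X]`-module `F^n` on which `X` acts by `A`. It is a direct sum of cyclic
modules `F[X] / (p ^ e)` with `p` monic irreducible, on which `X` acts by the companion matrix of
`p ^ e` (`exists_isSimilar_blockDiagonal_companion`).

The first two conditions are both used through a weaker common consequence: there is a matrix `D`
with `D A = -A D` that kills only vectors killed by `A ^ 2`. If `A = S + T` with `S`, `T`
square-zero, take `D = S - T`, for which `D ^ 2 = -A ^ 2`; if `A` is similar to `-A`, take for `D`
the invertible matrix realizing the similarity.

Such a `D` yields the block form (`exists_isSimilar_dg_of_anticommute`). It maps the primary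
component of `p` to that of `p' = ± p(-x)`, since a block of `D` between components whose
polynomials are not related in this way vanishes (`eq_zero_of_mul_companion_eq_neg`). The component
of `x` is the nilpotent block `N`. The components with `p' = p ≠ x` form `C`, because comparison of
coefficients shows that such `p` are even (here the characteristic matters). The remaining `p` come
in pairs `{p, p'}`; choosing one member of each pair splits the remaining space as `W ⊕ W'`, and
`D` exchanges `W` and `W'`. As `A` is invertible there, `D` is injective on both, hence
restricts to an isomorphism that conjugates the action on `W'` to the negative of the action on `W`
(`isSimilar_neg_of_swap`). No uniqueness of elementary divisors is needed.

Conversely, each block of the form admits an involution anticommuting with it: `X ⊕ -X` is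
anticommuted by the swap of its summands, and the companion matrix of an even polynomial or of a
power of `x` by `diag(1, -1, 1, …)`. Finally, an involution `V` with `A V = -V A` conjugates `A` to
`-A`, and `A = A (1 + V) / 2 + A (1 - V) / 2` is a sum of two square-zero matrices.
-/

namespace SquareZeroSums

open Matrix Polynomial

/-! ### Similarity of matrices -/

section Similarity

variable {F : Type*} [Field F]
variable {m n k m' n' : Type*} [Fintype m] [DecidableEq m] [Fintype n] [DecidableEq n]
  [Fintype k] [DecidableEq k] [Fintype m'] [DecidableEq m'] [Fintype n'] [DecidableEq n']

theorem IsSimilar.symm {A : Matrix m m F} {B : Matrix n n F} (h : IsSimilar A B) :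
    IsSimilar B A := by
  obtain ⟨P, Q, hPQ, hQP, rfl⟩ := h
  refine ⟨Q, P, hQP, hPQ, ?_⟩
  calc A = (P * Q) * A * (P * Q) := by rw [hPQ, Matrix.one_mul, Matrix.mul_one]
    _ = P * (Q * A * P) * Q := by simp only [Matrix.mul_assoc]

theorem IsSimilar.trans {A : Matrix m m F} {B : Matrix n n F} {C : Matrix k k F}
    (h : IsSimilar A B) (h' : IsSimilar B C) : IsSimilar A C := by
  obtain ⟨P, Q, hPQ, hQP, rfl⟩ := h
  obtain ⟨P', Q', hPQ', hQP', rfl⟩ := h'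
  refine ⟨P * P', Q' * Q, ?_, ?_, ?_⟩
  · rw [Matrix.mul_assoc, ← Matrix.mul_assoc P', hPQ', Matrix.one_mul, hPQ]
  · rw [Matrix.mul_assoc, ← Matrix.mul_assoc Q, hQP, Matrix.one_mul, hQP']
  · simp only [Matrix.mul_assoc]

theorem isSimilar_submatrix (A : Matrix m m F) (f : n ≃ m) : IsSimilar A (A.submatrix f f) := by
  refine ⟨(1 : Matrix m m F).submatrix id f, (1 : Matrix m m F).submatrix f id, ?_, ?_, ?_⟩
  · rw [← Matrix.submatrix_mul _ _ _ f _ f.bijective]; simp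
  · rw [← Matrix.submatrix_mul _ _ _ id _ Function.bijective_id]; simp
  · have := Matrix.submatrix_mul (1 : Matrix m m F) A f id id Function.bijective_id
    rw [Matrix.one_mul] at this
    have h2 := Matrix.submatrix_mul A (1 : Matrix m m F) f id f Function.bijective_id
    rw [Matrix.mul_one] at h2
    rw [h2, this]
    simp

theorem IsSimilar.dg {A : Matrix m m F} {B : Matrix n n F} {A' : Matrix m' m' F}
    {B' : Matrix n' n' F} (h : IsSimilar A A') (h' : IsSimilar B B') :
    IsSimilar (dg A B) (dg A' B') := by
  obtain ⟨P, Q, hPQ, hQP, rfl⟩ := h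
  obtain ⟨P', Q', hPQ', hQP', rfl⟩ := h'
  exact ⟨fromBlocks P 0 0 P', fromBlocks Q 0 0 Q', by simp [fromBlocks_multiply, *],
    by simp [fromBlocks_multiply, *], by simp [SquareZeroSums.dg, fromBlocks_multiply]⟩

theorem IsSimilar.neg {A : Matrix m m F} {B : Matrix n n F} (h : IsSimilar A B) :
    IsSimilar (-A) (-B) := by
  obtain ⟨P, Q, hPQ, hQP, rfl⟩ := h
  exact ⟨P, Q, hPQ, hQP, by simp⟩

theorem IsSimilar.pow {A : Matrix m m F} {B : Matrix n n F} (h : IsSimilar A B) (r : ℕ) :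
    IsSimilar (A ^ r) (B ^ r) := by
  obtain ⟨P, Q, hPQ, hQP, rfl⟩ := h
  refine ⟨P, Q, hPQ, hQP, ?_⟩
  induction r with
  | zero => simp [hQP]
  | succ r ih =>
    rw [pow_succ, ih, pow_succ]
    calc Q * A ^ r * P * (Q * A * P) = Q * A ^ r * (P * Q) * A * P := by
          simp only [Matrix.mul_assoc]
      _ = _ := by rw [hPQ, Matrix.mul_one]; simp only [Matrix.mul_assoc]

theorem IsSimilar.isNilpotent {A : Matrix m m F} {B : Matrix n n F} (h : IsSimilar A B)
    (hA : IsNilpotent A) : IsNilpotent B := by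
  obtain ⟨r, hr⟩ := hA
  obtain ⟨P, Q, -, -, hB⟩ := h.pow r
  exact ⟨r, by rw [hB, hr]; simp⟩

theorem IsSimilar.isUnit {A : Matrix m m F} {B : Matrix n n F} (h : IsSimilar A B)
    (hA : IsUnit A) : IsUnit B := by
  obtain ⟨P, Q, hPQ, hQP, rfl⟩ := h
  obtain ⟨A', h1, h2⟩ := isUnit_iff_exists.1 hA
  refine isUnit_iff_exists.2 ⟨Q * A' * P, ?_, ?_⟩
  · calc Q * A * P * (Q * A' * P) = Q * A * (P * Q) * A' * P := by simp only [Matrix.mul_assoc]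
      _ = 1 := by rw [hPQ, Matrix.mul_one, Matrix.mul_assoc Q, h1, Matrix.mul_one, hQP]
  · calc Q * A' * P * (Q * A * P) = Q * A' * (P * Q) * A * P := by simp only [Matrix.mul_assoc]
      _ = 1 := by rw [hPQ, Matrix.mul_one, Matrix.mul_assoc Q, h2, Matrix.mul_one, hQP]

end Similarity

/-! ### Companion matrices -/

section Companion

variable {F : Type*} [Field F]

/-- The companion matrix is the matrix of the multiplication by the root in the power basis of
`F[X] / (f)`. -/
theorem leftMulMatrix_root_eq_companion {f : F[X]} (hf : f.Monic) :
    Algebra.leftMulMatrix (AdjoinRoot.powerBasis' hf).basis (AdjoinRoot.root f)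
      = companion f := by
  have h : (AdjoinRoot.powerBasis' hf).minpolyGen = f := by
    refine eq_of_monic_of_dvd_of_natDegree_le hf
      (AdjoinRoot.powerBasis' hf).minpolyGen_monic ?_ ?_
    · have h0 := (AdjoinRoot.powerBasis' hf).aeval_minpolyGen
      rw [AdjoinRoot.powerBasis'_gen, AdjoinRoot.aeval_eq, AdjoinRoot.mk_eq_zero] at h0
      exact h0
    · rw [PowerBasis.natDegree_minpolyGen]; rfl
  have := (AdjoinRoot.powerBasis' hf).leftMulMatrix
  rw [h] at this
  exact this

theorem aeval_companion_eq_zero_iff {f : F[X]} (hf : f.Monic) (g : F[X]) :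
    aeval (companion f) g = 0 ↔ f ∣ g := by
  have h : aeval (companion f) g =
      Algebra.leftMulMatrix (AdjoinRoot.powerBasis' hf).basis (AdjoinRoot.mk f g) := by
    rw [← AdjoinRoot.aeval_eq, ← leftMulMatrix_root_eq_companion hf]
    exact aeval_algHom_apply _ _ _
  rw [h, ← AdjoinRoot.mk_eq_zero]
  exact map_eq_zero_iff _ (Algebra.leftMulMatrix_injective _)

theorem aeval_companion_self {f : F[X]} (hf : f.Monic) : aeval (companion f) f = 0 :=
  (aeval_companion_eq_zero_iff hf f).2 dvd_rfl

/-- If `u * X + v * f = 1`, then `u` evaluated at the companion matrix is its inverse. -/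
theorem isUnit_companion {f : F[X]} (hf : f.Monic) (h : IsCoprime X f) :
    IsUnit (companion f) := by
  obtain ⟨u, v, huv⟩ := h
  have := congrArg (aeval (companion f)) huv
  simp only [map_add, map_mul, aeval_X, aeval_companion_self hf, mul_zero, add_zero,
    map_one] at this
  have h2 : companion f * aeval (companion f) u = 1 := _root_.mul_eq_one_comm.1 this
  exact isUnit_iff_exists.2 ⟨_, h2, this⟩

/-- A Sylvester-type vanishing statement: a matrix `D` that intertwines `companion f` with
`-companion g` also intertwines the polynomial values, so `(f(-x))(companion g) * D = 0`; the first
factor is invertible as soon as `f(-x)` and `g` are coprime. -/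
theorem eq_zero_of_mul_companion_eq_neg {f g : F[X]} (hf : f.Monic) (hg : g.Monic)
    (hfg : IsCoprime (f.comp (-X)) g)
    {D : Matrix (Fin g.natDegree) (Fin f.natDegree) F}
    (hD : D * companion f = -(companion g * D)) : D = 0 := by
  have key : ∀ q : F[X], D * aeval (companion f) q = aeval (companion g) (q.comp (-X)) * D := by
    intro q
    induction q using Polynomial.induction_on' with
    | add p q hp hq => simp only [map_add, add_comp, Matrix.mul_add, Matrix.add_mul, hp, hq]
    | monomial r a =>
      induction r generalizing a with
      | zero => simp [Algebra.algebraMap_eq_smul_one]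
      | succ r ih =>
        have h1 : (monomial (r + 1) a : F[X]) = monomial r a * X := by simp
        rw [h1, mul_comp, map_mul, map_mul, aeval_X, X_comp, ← Matrix.mul_assoc, ih,
          Matrix.mul_assoc, hD, map_neg, aeval_X]
        simp [Matrix.mul_assoc]
  obtain ⟨u, v, huv⟩ := hfg
  have h := congrArg (aeval (companion g)) huv
  simp only [map_add, map_mul, aeval_companion_self hg, mul_zero, add_zero, map_one] at h
  have h3 := key f
  rw [aeval_companion_self hf, Matrix.mul_zero] at h3
  rw [← Matrix.one_mul D, ← h, Matrix.mul_assoc, ← h3, Matrix.mul_zero]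

end Companion

/-! ### The primary cyclic decomposition -/

/-- The quotient by `r`, as a vector space over `F` with the action of `X`, is `AdjoinRoot f` for any
generator `f` of the same ideal. -/
theorem exists_linearEquiv_adjoinRoot {F : Type*} [Field F] {f r : F[X]}
    (h : Submodule.span F[X] {r} = Ideal.span {f}) :
    ∃ g : (F[X] ⧸ Submodule.span F[X] {r}) ≃ₗ[F] AdjoinRoot f,
      ∀ x, g ((X : F[X]) • x) = AdjoinRoot.root f * g x := by
  let g : (F[X] ⧸ Ideal.span {f}) ≃ₗ[F] AdjoinRoot f :=
    { AddEquiv.refl _ with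
      map_smul' := fun c x => by
        obtain ⟨r, rfl⟩ := Ideal.Quotient.mk_surjective x
        rfl }
  have hg : ∀ x, g ((X : F[X]) • x) = AdjoinRoot.root f * g x := by
    intro x
    obtain ⟨r, rfl⟩ := Ideal.Quotient.mk_surjective x
    rfl
  refine ⟨(Submodule.quotEquivOfEq _ _ h).restrictScalars F ≪≫ₗ g, fun x => ?_⟩
  simp only [LinearEquiv.trans_apply, LinearEquiv.restrictScalars_apply, map_smul]
  exact hg _

/-- The primary cyclic decomposition: `F^n`, as a module over `F[X]` via `A`, is a direct sum of
modules `F[X] / (p ^ e)`, and the multiplication by `X` on such a summand has matrix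
`companion (p ^ e)` in the basis `1, X, X², …`. -/
theorem exists_isSimilar_blockDiagonal_companion.{u} {F : Type u} [Field F] {n : Type*}
    [Fintype n] [DecidableEq n] (A : Matrix n n F) :
    ∃ (ι : Type u) (_ : Fintype ι) (_ : DecidableEq ι) (p : ι → F[X]) (e : ι → ℕ),
      (∀ i, (p i).Monic ∧ Irreducible (p i)) ∧
      IsSimilar A (blockDiagonal' fun i => companion (p i ^ e i)) := by
  classical
  let φ : Module.End F (n → F) := Matrix.toLin' A
  have htors : Module.IsTorsion F[X] (Module.AEval' φ) := by
    intro x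
    refine ⟨⟨φ.charpoly, mem_nonZeroDivisors_of_ne_zero φ.charpoly_monic.ne_zero⟩, ?_⟩
    have := Module.AEval.of_aeval_smul (a := φ) φ.charpoly ((Module.AEval.of F (n → F) φ).symm x)
    rw [LinearMap.aeval_self_charpoly, LinearEquiv.apply_symm_apply] at this
    rw [Submonoid.mk_smul, ← this, zero_smul, map_zero]
  obtain ⟨ι, hι, p, hp, e, ⟨l⟩⟩ := Module.equiv_directSum_of_isTorsion htors
  let q : ι → F[X] := fun i => normalize (p i)
  have hq : ∀ i, (q i).Monic := fun i => monic_normalize (hp i).ne_zero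
  have hqp : ∀ i, Associated (p i) (q i) := fun i => (normalize_associated (p i)).symm
  let f : ι → F[X] := fun i => q i ^ e i
  have hf : ∀ i, (f i).Monic := fun i => (hq i).pow _
  have hspan : ∀ i, Submodule.span F[X] {p i ^ e i} = Ideal.span {f i} := fun i =>
    Ideal.span_singleton_eq_span_singleton.2 ((hqp i).pow_pow)
  choose g hg using fun i => exists_linearEquiv_adjoinRoot (hspan i)
  obtain ⟨E, hE⟩ : ∃ E : (n → F) ≃ₗ[F] ∀ i, AdjoinRoot (f i),
      ∀ v i, E (φ v) i = AdjoinRoot.root (f i) * E v i := by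
    let E₀ : Module.AEval' φ ≃ₗ[F[X]] ∀ i, F[X] ⧸ Submodule.span F[X] {p i ^ e i} :=
      l ≪≫ₗ DirectSum.linearEquivFunOnFintype F[X] ι _
    refine ⟨Module.AEval'.of φ ≪≫ₗ E₀.restrictScalars F ≪≫ₗ LinearEquiv.piCongrRight g,
      fun v i => ?_⟩
    simp only [LinearEquiv.trans_apply, LinearEquiv.piCongrRight_apply,
      LinearEquiv.restrictScalars_apply]
    rw [← Module.AEval'.X_smul_of, map_smul, Pi.smul_apply, hg]
  let b' : Module.Basis (Σ i, Fin (f i).natDegree) F (∀ i, AdjoinRoot (f i)) :=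
    Pi.basis fun i => (AdjoinRoot.powerBasis' (hf i)).basis
  let b : Module.Basis (Σ i, Fin (f i).natDegree) F (n → F) := b'.map E.symm
  refine ⟨ι, hι, Classical.decEq ι, q, e, fun i => ⟨hq i, (hqp i).irreducible (hp i)⟩,
    (Pi.basisFun F n).toMatrix b, b.toMatrix (Pi.basisFun F n),
    Module.Basis.toMatrix_mul_toMatrix_flip _ _, Module.Basis.toMatrix_mul_toMatrix_flip _ _, ?_⟩
  have hA : A = LinearMap.toMatrix (Pi.basisFun F n) (Pi.basisFun F n) φ := by
    rw [← LinearMap.toMatrix'_toLin' A]; rfl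
  conv_rhs => rw [hA]
  rw [basis_toMatrix_mul_linearMap_toMatrix_mul_basis_toMatrix]
  ext ⟨i, x⟩ ⟨j, y⟩
  rw [LinearMap.toMatrix_apply]
  have h1 : b.repr (φ (b ⟨j, y⟩)) = b'.repr (E (φ (b ⟨j, y⟩))) := rfl
  have h2 : E (b ⟨j, y⟩) = Pi.single j ((AdjoinRoot.powerBasis' (hf j)).basis y) := by
    have : E (E.symm (b' ⟨j, y⟩)) = b' ⟨j, y⟩ := E.apply_symm_apply _
    exact this.trans (Pi.basis_apply _ _)
  have h3 : ∀ z, b'.repr z ⟨i, x⟩ = (AdjoinRoot.powerBasis' (hf i)).basis.repr (z i) x :=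
    fun z => Pi.basis_repr _ _ _
  rw [h1, funext (hE _), h2]
  refine Eq.trans ?_ (h3 _).symm
  by_cases hij : i = j
  · subst hij
    rw [blockDiagonal'_apply_eq, ← leftMulMatrix_root_eq_companion (hf i), Pi.single_eq_same]
    exact Algebra.leftMulMatrix_eq_repr_mul _ _ _ _
  · rw [blockDiagonal'_apply_ne _ _ _ hij, Pi.single_eq_of_ne hij, mul_zero, map_zero]
    rfl

/-! ### Involutions anticommuting with a matrix -/

section Involution

variable {F : Type*} [Field F]
variable {m n : Type*} [Fintype m] [DecidableEq m] [Fintype n] [DecidableEq n]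

/-- There is an involution anticommuting with `A`. -/
def HasSkewInvolution (A : Matrix m m F) : Prop :=
  ∃ V : Matrix m m F, IsInvolution V ∧ A * V = -(V * A)

theorem HasSkewInvolution.of_isSimilar {A : Matrix m m F} {B : Matrix n n F}
    (hA : HasSkewInvolution A) (h : IsSimilar A B) : HasSkewInvolution B := by
  obtain ⟨V, hV, hAV⟩ := hA
  obtain ⟨P, Q, hPQ, hQP, rfl⟩ := h
  have hmul : ∀ Y Z : Matrix m m F, Q * Y * P * (Q * Z * P) = Q * (Y * Z) * P := by
    intro Y Z
    calc Q * Y * P * (Q * Z * P) = Q * Y * (P * Q) * Z * P := by simp only [Matrix.mul_assoc]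
      _ = _ := by rw [hPQ, Matrix.mul_one]; simp only [Matrix.mul_assoc]
  refine ⟨Q * V * P, ?_, ?_⟩
  · rw [IsInvolution, pow_two] at *
    rw [hmul, hV, Matrix.mul_one, hQP]
  · rw [hmul, hmul, hAV]
    simp

theorem HasSkewInvolution.dg {A : Matrix m m F} {B : Matrix n n F}
    (hA : HasSkewInvolution A) (hB : HasSkewInvolution B) : HasSkewInvolution (dg A B) := by
  obtain ⟨V, hV, hAV⟩ := hA
  obtain ⟨W, hW, hBW⟩ := hB
  rw [IsInvolution, pow_two] at hV hW
  refine ⟨fromBlocks V 0 0 W, ?_, ?_⟩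
  · simp [IsInvolution, pow_two, fromBlocks_multiply, hV, hW]
  · simp [SquareZeroSums.dg, fromBlocks_multiply, fromBlocks_neg, hAV, hBW]

/-- The swap of the two summands anticommutes with `X ⊕ -X`. -/
theorem hasSkewInvolution_dg_neg (X : Matrix m m F) : HasSkewInvolution (dg X (-X)) := by
  refine ⟨fromBlocks 0 1 1 0, ?_, ?_⟩
  · simp [IsInvolution, pow_two, fromBlocks_multiply]
  · simp [dg, fromBlocks_multiply, fromBlocks_neg]

theorem hasSkewInvolution_blockDiagonal' {ι : Type*} [Fintype ι] [DecidableEq ι] {m : ι → Type*}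
    [∀ i, Fintype (m i)] [∀ i, DecidableEq (m i)] {M : ∀ i, Matrix (m i) (m i) F}
    (h : ∀ i, HasSkewInvolution (M i)) : HasSkewInvolution (blockDiagonal' M) := by
  choose V hV hMV using h
  refine ⟨blockDiagonal' V, ?_, ?_⟩
  · rw [IsInvolution, ← blockDiagonal'_pow, ← blockDiagonal'_one]
    exact congrArg _ (funext hV)
  · rw [← blockDiagonal'_mul, ← blockDiagonal'_mul, ← blockDiagonal'_neg]
    exact congrArg _ (funext hMV)

/-- If all exponents occurring in `f` have the same parity, then the companion matrix of `f` is odd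
for the `ℤ/2`-grading by the parity of the index, so `diag(1, -1, 1, …)` anticommutes with it. -/
theorem hasSkewInvolution_companion {f : F[X]}
    (hf : ∀ i, f.coeff i ≠ 0 → Even (i + f.natDegree)) : HasSkewInvolution (companion f) := by
  refine ⟨diagonal fun i => (-1) ^ (i : ℕ), ?_, ?_⟩
  · rw [IsInvolution, diagonal_pow, ← diagonal_one]
    congr 1
    funext i
    simp [← pow_mul]
  · ext i j
    rw [mul_diagonal, neg_apply, diagonal_mul]
    by_cases h : companion f i j = 0
    · simp [h]
    -- A nonzero entry sits on the subdiagonal or in the last column `j = natDegree f - 1`.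
    have hpar : Odd ((i : ℕ) + j) := by
      simp only [companion, of_apply] at h
      split_ifs at h with h1 h2
      · have := hf i (by simpa using h)
        grind
      · grind
      · exact absurd rfl h
    have hij : (-1 : F) ^ (j : ℕ) = -(-1) ^ (i : ℕ) := by
      rcases Nat.even_or_odd (i : ℕ) with hi | hi
      · rw [hi.neg_one_pow, Odd.neg_one_pow (by grind)]
      · rw [hi.neg_one_pow, Even.neg_one_pow (by grind), neg_neg]
    rw [hij]
    ring

theorem IsEvenPoly.even_of_coeff_ne_zero {p : F[X]} (hp : IsEvenPoly p) {i : ℕ}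
    (hi : p.coeff i ≠ 0) : Even i := by
  obtain ⟨q, rfl⟩ := hp
  rw [← expand_eq_comp_X_pow, coeff_expand two_pos] at hi
  by_contra h
  exact hi (if_neg fun h2 => h (even_iff_two_dvd.2 h2))

theorem IsEvenPoly.pow {p : F[X]} (hp : IsEvenPoly p) (e : ℕ) : IsEvenPoly (p ^ e) := by
  obtain ⟨q, rfl⟩ := hp
  exact ⟨q ^ e, by rw [pow_comp]⟩

theorem IsEvenPrimaryForm.hasSkewInvolution {C : Matrix m m F} (hC : IsEvenPrimaryForm C) :
    HasSkewInvolution C := by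
  obtain ⟨t, p, e, hp, h⟩ := hC
  refine (hasSkewInvolution_blockDiagonal' fun i => ?_).of_isSimilar h.symm
  have heven := (hp i).2.2.1.pow (e i)
  refine hasSkewInvolution_companion fun j hj => (heven.even_of_coeff_ne_zero hj).add ?_
  refine heven.even_of_coeff_ne_zero ?_
  rw [((hp i).1.pow (e i)).coeff_natDegree]
  exact one_ne_zero

/-- The primary cyclic decomposition of a nilpotent matrix involves only companion matrices of
powers of `X`, that is, nilpotent Jordan blocks. -/
theorem hasSkewInvolution_of_isNilpotent {N : Matrix m m F} (hN : IsNilpotent N) :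
    HasSkewInvolution N := by
  obtain ⟨ι, _, _, p, e, hp, h⟩ := exists_isSimilar_blockDiagonal_companion N
  obtain ⟨r, hr⟩ := h.isNilpotent hN
  refine (hasSkewInvolution_blockDiagonal' fun i => ?_).of_isSimilar h.symm
  rw [← blockDiagonal'_pow] at hr
  have hi : companion (p i ^ e i) ^ r = 0 :=
    congrFun (blockDiagonal'_injective (hr.trans blockDiagonal'_zero.symm)) i
  have hdvd : p i ^ e i ∣ X ^ r := by
    rw [← aeval_companion_eq_zero_iff ((hp i).1.pow _), map_pow, aeval_X, hi]
  have hf : p i ^ e i = X ^ e i := by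
    rcases Nat.eq_zero_or_pos (e i) with h0 | h0
    · rw [h0, pow_zero, pow_zero]
    · have h1 : p i ∣ X :=
        (hp i).2.prime.dvd_of_dvd_pow ((dvd_pow_self _ h0.ne').trans hdvd)
      rw [eq_of_monic_of_associated (hp i).1 monic_X
        ((hp i).2.associated_of_dvd irreducible_X h1)]
  rw [hf]
  refine hasSkewInvolution_companion fun j hj => ?_
  rw [coeff_X_pow] at hj
  rw [natDegree_X_pow, (by simpa using hj : j = e i)]
  exact ⟨_, rfl⟩

end Involution

/-! ### The polynomial `± p(-x)` -/

section NegArg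

variable {F : Type*} [Field F]

/-- The monic polynomial `± p(-x)`, whose roots are the negatives of the roots of the monic
polynomial `p`. -/
noncomputable def negArg (p : F[X]) : F[X] :=
  (-1) ^ p.natDegree * p.comp (-X)

theorem natDegree_comp_neg_X (p : F[X]) : (p.comp (-X)).natDegree = p.natDegree := by
  simp [natDegree_comp]

theorem natDegree_negArg (p : F[X]) : (negArg p).natDegree = p.natDegree := by
  rw [negArg]
  rcases neg_one_pow_eq_or F[X] p.natDegree with h | h <;> rw [h] <;>
    simp [natDegree_comp_neg_X]

theorem monic_negArg {p : F[X]} (hp : p.Monic) : (negArg p).Monic :=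
  hp.neg_one_pow_natDegree_mul_comp_neg_X

theorem negArg_negArg (p : F[X]) : negArg (negArg p) = p := by
  have h : (negArg p).comp (-X) = (-1) ^ p.natDegree * p := by
    rw [negArg, mul_comp, comp_neg_X_comp_neg_X]
    simp
  rw [negArg, natDegree_negArg, h, ← mul_assoc, ← mul_pow]
  simp

theorem negArg_X : negArg (X : F[X]) = X := by
  simp [negArg]

/-- For irreducible polynomials, `p(-x)` fails to be coprime to `q` only if `q = ± p(-x)`. -/
theorem eq_negArg_of_not_isCoprime {p q : F[X]} (hp : p.Monic) (hpi : Irreducible p)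
    (hq : q.Monic) (hqi : Irreducible q) (h : ¬ IsCoprime (p.comp (-X)) q) : q = negArg p := by
  have hdvd : q ∣ p.comp (-X) := by
    by_contra h2
    exact h ((hqi.coprime_iff_not_dvd).2 h2).symm
  -- By symmetry `q(-x)` divides the irreducible `p`, which forces equal degrees.
  have hdvd' : q.comp (-X) ∣ p := (dvd_comp_neg_X_iff q p).1 hdvd
  have hdeg : q.natDegree = p.natDegree := by
    rw [← natDegree_comp_neg_X q]
    rcases hpi.dvd_iff.1 hdvd' with hu | ha
    · have h1 := natDegree_eq_zero_of_isUnit hu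
      rw [natDegree_comp_neg_X] at h1
      exact absurd h1 hqi.natDegree_pos.ne'
    · exact (natDegree_eq_of_degree_eq (degree_eq_degree_of_associated ha)).symm
  refine (eq_of_monic_of_dvd_of_natDegree_le hq (monic_negArg hp) (hdvd.mul_left _) ?_).symm
  rw [natDegree_negArg, hdeg]

theorem coeff_zero_ne_zero {p : F[X]} (hp : p.Monic) (hpi : Irreducible p) (hX : p ≠ X) :
    p.coeff 0 ≠ 0 := fun h =>
  hX (eq_of_monic_of_associated hp monic_X
    ((irreducible_X.associated_of_dvd hpi (X_dvd_iff.2 h)).symm))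

/-- Comparing coefficients in `p = ± p(-x)`; the nonzero constant term forces the sign `+`. -/
theorem isEvenPoly_of_negArg_eq (h2 : (2 : F) ≠ 0) {p : F[X]} (h0 : p.coeff 0 ≠ 0)
    (h : negArg p = p) : IsEvenPoly p := by
  have hc : ∀ i, (-1) ^ p.natDegree * ((-1) ^ i * p.coeff i) = p.coeff i := by
    intro i
    conv_rhs => rw [← h, negArg]
    have : ((-1 : F[X]) ^ p.natDegree) = C ((-1) ^ p.natDegree) := by simp
    rw [this, coeff_C_mul]
    congr 1
    rw [show (-X : F[X]) = C (-1) * X by simp, comp_C_mul_X_coeff, mul_comm]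
  have hne : (-1 : F) ≠ 1 := by
    intro h1
    apply h2
    linear_combination -h1
  have hd : (-1 : F) ^ p.natDegree = 1 := by
    have := hc 0
    rw [pow_zero, one_mul] at this
    exact mul_right_cancel₀ h0 (this.trans (one_mul _).symm)
  have hodd : ∀ i, ¬ 2 ∣ i → p.coeff i = 0 := by
    intro i hi
    have h1 := hc i
    have : Odd i := by rwa [← Nat.not_even_iff_odd, even_iff_two_dvd]
    rw [hd, one_mul, this.neg_one_pow] at h1
    have h3 : 2 * p.coeff i = 0 := by linear_combination -h1
    exact (mul_eq_zero.1 h3).resolve_left h2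
  refine ⟨contract 2 p, ?_⟩
  rw [← expand_eq_comp_X_pow]
  ext i
  rw [coeff_expand two_pos]
  split_ifs with hi
  · rw [coeff_contract two_ne_zero, Nat.div_mul_cancel hi]
  · exact hodd i hi

end NegArg

/-! ### Anticommuting matrices that exchange two invariant summands -/

/-- If `B` is invertible on the invariant summand `E`, and `D` kills only vectors killed by `B ^ 2`,
then the restriction `K` of `D` to `E` is injective. -/
theorem eq_zero_of_mulVec_eq_zero {F n a b : Type*} [Field F] [Fintype n] [DecidableEq n]
    [Fintype a] [DecidableEq a] [Fintype b] {B D : Matrix n n F}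
    (hker : ∀ v : n → F, D *ᵥ v = 0 → (B ^ 2) *ᵥ v = 0)
    {E : Matrix n a F} {E' : Matrix a n F} {G : Matrix n b F} {N : Matrix a a F}
    {K : Matrix b a F} (hE : E' * E = 1) (hBE : B * E = E * N) (hN : IsUnit N)
    (hDE : D * E = G * K) (w : a → F) (hw : K *ᵥ w = 0) : w = 0 := by
  have h1 : (B ^ 2) *ᵥ (E *ᵥ w) = 0 := by
    apply hker
    rw [mulVec_mulVec, hDE, ← mulVec_mulVec, hw, mulVec_zero]
  have h2 : B ^ 2 * E = E * N ^ 2 := by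
    rw [pow_two, Matrix.mul_assoc, hBE, ← Matrix.mul_assoc, hBE, Matrix.mul_assoc, pow_two]
  rw [mulVec_mulVec, h2] at h1
  have h3 : (N ^ 2) *ᵥ w = 0 := by
    have := congrArg (E' *ᵥ ·) h1
    simpa only [mulVec_mulVec, ← Matrix.mul_assoc, hE, Matrix.one_mul, mulVec_zero] using this
  exact mulVec_injective_iff_isUnit.2 (hN.pow 2) (h3.trans (mulVec_zero _).symm)

/-- If `B` and `D` anticommute, then `D` maps the `B`-invariant summands `E₁`, `E₂` to each other
and intertwines `B` with `-B`. When `B` is invertible on both summands, the kernel condition makes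
`D` injective on each of them, so the two restrictions of `D` are mutually inverse up to
automorphisms. -/
theorem isSimilar_neg_of_swap {F n a b : Type*} [Field F] [Fintype n] [DecidableEq n]
    [Fintype a] [DecidableEq a] [Fintype b] [DecidableEq b]
    {B D : Matrix n n F} (hD : D * B = -(B * D))
    (hker : ∀ v : n → F, D *ᵥ v = 0 → (B ^ 2) *ᵥ v = 0)
    {E₁ : Matrix n a F} {E₂ : Matrix n b F} {E₁' : Matrix a n F} {E₂' : Matrix b n F}
    (h₁ : E₁' * E₁ = 1) (h₂ : E₂' * E₂ = 1) {B₁ : Matrix a a F} {B₂ : Matrix b b F}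
    (hB₁ : B * E₁ = E₁ * B₁) (hB₂ : B * E₂ = E₂ * B₂) (hu₁ : IsUnit B₁) (hu₂ : IsUnit B₂)
    {D₁ : Matrix b a F} {D₂ : Matrix a b F} (hD₁ : D * E₁ = E₂ * D₁) (hD₂ : D * E₂ = E₁ * D₂) :
    IsSimilar B₂ (-B₁) := by
  -- Both composites are injective square matrices, so `D₁` has a left and a right inverse.
  have inj₁ := eq_zero_of_mulVec_eq_zero hker h₁ hB₁ hu₁ hD₁
  have inj₂ := eq_zero_of_mulVec_eq_zero hker h₂ hB₂ hu₂ hD₂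
  have unit₁ : IsUnit (D₂ * D₁) := by
    rw [← mulVec_injective_iff_isUnit]
    refine (injective_iff_map_eq_zero (mulVecLin (D₂ * D₁))).2 fun w hw => ?_
    rw [mulVecLin_apply, ← mulVec_mulVec] at hw
    exact inj₁ w (inj₂ _ hw)
  have unit₂ : IsUnit (D₁ * D₂) := by
    rw [← mulVec_injective_iff_isUnit]
    refine (injective_iff_map_eq_zero (mulVecLin (D₁ * D₂))).2 fun w hw => ?_
    rw [mulVecLin_apply, ← mulVec_mulVec] at hw
    exact inj₂ w (inj₁ _ hw)
  obtain ⟨U, -, hU⟩ := isUnit_iff_exists.1 unit₁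
  obtain ⟨W, hW, -⟩ := isUnit_iff_exists.1 unit₂
  have hL : (U * D₂) * D₁ = 1 := by rw [Matrix.mul_assoc, hU]
  have hR : D₁ * (D₂ * W) = 1 := by rw [← Matrix.mul_assoc, hW]
  have hLR : U * D₂ = D₂ * W := by
    rw [← Matrix.mul_one (U * D₂), ← hR, ← Matrix.mul_assoc, hL, Matrix.one_mul]
  have hrel : D₁ * B₁ = -(B₂ * D₁) := by
    have h : E₂ * (D₁ * B₁) = E₂ * (-(B₂ * D₁)) := by
      rw [← Matrix.mul_assoc, ← hD₁, Matrix.mul_assoc, ← hB₁, ← Matrix.mul_assoc, hD,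
        Matrix.neg_mul, Matrix.mul_assoc, hD₁, ← Matrix.mul_assoc, hB₂, Matrix.mul_neg,
        Matrix.mul_assoc]
    have := congrArg (E₂' * ·) h
    simpa only [← Matrix.mul_assoc, h₂, Matrix.one_mul, Matrix.mul_neg] using this
  refine ⟨D₁, U * D₂, hLR ▸ hR, hL, ?_⟩
  rw [Matrix.mul_assoc, ← neg_eq_iff_eq_neg.2 hrel, Matrix.mul_neg, ← Matrix.mul_assoc, hL,
    Matrix.one_mul]

/-! ### Sorting the blocks of a block diagonal matrix -/

section Classes

variable {F ι κ : Type*} [Field F] {m : ι → Type*}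

/-- The inclusion into `Σ i, m i` of the indices whose first component has class `k`. -/
def classIncl (m : ι → Type*) (c : ι → κ) (k : κ) (x : Σ i : {i // c i = k}, m i) : Σ i, m i :=
  ⟨x.1.1, x.2⟩

theorem classIncl_injective (c : ι → κ) (k : κ) : Function.Injective (classIncl m c k) := by
  rintro ⟨⟨i, hi⟩, x⟩ ⟨⟨j, hj⟩, y⟩ h
  simp only [classIncl, Sigma.mk.injEq] at h
  obtain ⟨rfl, h⟩ := h
  rw [eq_of_heq h]

theorem exists_classIncl_eq {c : ι → κ} {k : κ} {a : Σ i, m i} (h : c a.1 = k) :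
    ∃ x, classIncl m c k x = a :=
  ⟨⟨⟨a.1, h⟩, a.2⟩, rfl⟩

variable [DecidableEq ι]

/-- The part of the block diagonal matrix `M` made of the blocks of class `k`. -/
def classBlock (M : ∀ i, Matrix (m i) (m i) F) (c : ι → κ) (k : κ) :
    Matrix (Σ i : {i // c i = k}, m i) (Σ i : {i // c i = k}, m i) F :=
  blockDiagonal' fun i => M i

theorem blockDiagonal'_apply_classIncl (M : ∀ i, Matrix (m i) (m i) F) (c : ι → κ) (k : κ)
    (x y : Σ i : {i // c i = k}, m i) :
    blockDiagonal' M (classIncl m c k x) (classIncl m c k y) = classBlock M c k x y := by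
  obtain ⟨i, x⟩ := x
  obtain ⟨j, y⟩ := y
  rw [classBlock]
  by_cases h : i = j
  · subst h
    rw [blockDiagonal'_apply_eq]
    exact blockDiagonal'_apply_eq M _ x y
  · rw [blockDiagonal'_apply_ne _ _ _ h]
    exact blockDiagonal'_apply_ne M x y fun h' => h (Subtype.ext h')

theorem blockDiagonal'_apply_eq_zero_of_class_ne (M : ∀ i, Matrix (m i) (m i) F) {c : ι → κ}
    {a b : Σ i, m i} (h : c a.1 ≠ c b.1) : blockDiagonal' M a b = 0 :=
  blockDiagonal'_apply_ne M _ _ fun h' => h (congrArg c h')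

/-- The coordinate inclusion of the vectors supported on class `k`. -/
def classEmb (F : Type*) [Field F] (m : ι → Type*) [∀ i, DecidableEq (m i)]
    (c : ι → κ) (k : κ) : Matrix (Σ i, m i) (Σ i : {i // c i = k}, m i) F :=
  (1 : Matrix (Σ i, m i) (Σ i, m i) F).submatrix id (classIncl m c k)

variable [Fintype ι] [∀ i, Fintype (m i)]

theorem mul_blockDiagonal'_apply {l : Type*} (N : Matrix l (Σ i, m i) F)
    (M : ∀ i, Matrix (m i) (m i) F) (a : l) (j : ι) (y : m j) :
    (N * blockDiagonal' M) a ⟨j, y⟩ = ∑ z, N a ⟨j, z⟩ * M j z y := by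
  rw [Matrix.mul_apply, Fintype.sum_sigma, Finset.sum_eq_single j]
  · simp only [blockDiagonal'_apply_eq]
  · intro i _ hij
    exact Finset.sum_eq_zero fun z _ => by rw [blockDiagonal'_apply_ne M _ _ hij, mul_zero]
  · simp

theorem blockDiagonal'_mul_apply {l : Type*} (N : Matrix (Σ i, m i) l F)
    (M : ∀ i, Matrix (m i) (m i) F) (i : ι) (x : m i) (b : l) :
    (blockDiagonal' M * N) ⟨i, x⟩ b = ∑ z, M i x z * N ⟨i, z⟩ b := by
  rw [Matrix.mul_apply, Fintype.sum_sigma, Finset.sum_eq_single i]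
  · simp only [blockDiagonal'_apply_eq]
  · intro j _ hij
    exact Finset.sum_eq_zero fun z _ => by rw [blockDiagonal'_apply_ne M _ _ hij.symm, zero_mul]
  · simp

variable [∀ i, DecidableEq (m i)]

-- Instances on the nested sums of index types exceed the default size bound.
set_option synthInstance.maxSize 1024 in
theorem blockDiagonal'_isSimilar_dg (M : ∀ i, Matrix (m i) (m i) F) (c : ι → Fin 4) :
    IsSimilar (blockDiagonal' M) (dg (classBlock M c 0)
      (dg (classBlock M c 1) (dg (classBlock M c 2) (classBlock M c 3)))) := by
  let f := Sum.elim (classIncl m c 0)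
    (Sum.elim (classIncl m c 1) (Sum.elim (classIncl m c 2) (classIncl m c 3)))
  have hc : ∀ k x, c (classIncl m c k x).1 = k := fun k x => x.1.2
  have hne : ∀ {k l : Fin 4} (x y), k ≠ l → classIncl m c k x ≠ classIncl m c l y :=
    fun x y hkl h => hkl (by rw [← hc _ x, h, hc])
  have hf : Function.Bijective f := by
    constructor
    · rintro (x | x | x | x) (y | y | y | y) h
      all_goals first
        | rw [classIncl_injective c _ h]
        | exact absurd h (hne x y (by decide))
    · intro a
      have h4 : ∀ k : Fin 4, k = 0 ∨ k = 1 ∨ k = 2 ∨ k = 3 := by decide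
      rcases h4 (c a.1) with h | h | h | h
      all_goals obtain ⟨x, hx⟩ := exists_classIncl_eq h
      · exact ⟨Sum.inl x, hx⟩
      · exact ⟨Sum.inr (Sum.inl x), hx⟩
      · exact ⟨Sum.inr (Sum.inr (Sum.inl x)), hx⟩
      · exact ⟨Sum.inr (Sum.inr (Sum.inr x)), hx⟩
  convert isSimilar_submatrix (blockDiagonal' M) (Equiv.ofBijective f hf) using 1
  ext (x | x | x | x) (y | y | y | y)
  all_goals first
    | exact (blockDiagonal'_apply_classIncl M c _ x y).symm
    | exact (blockDiagonal'_apply_eq_zero_of_class_ne M (c := c)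
        (by change c (classIncl m c _ x).1 ≠ c (classIncl m c _ y).1; rw [hc, hc]; decide)).symm

theorem mul_classEmb {l : Type*} (N : Matrix l (Σ i, m i) F) (c : ι → κ) (k : κ) :
    N * classEmb F m c k = N.submatrix id (classIncl m c k) := by
  have := submatrix_mul N (1 : Matrix (Σ i, m i) (Σ i, m i) F) id id (classIncl m c k)
    Function.bijective_id
  rw [Matrix.mul_one] at this
  exact this.symm

theorem transpose_classEmb_mul_self (c : ι → κ) (k : κ) :
    (classEmb F m c k)ᵀ * classEmb F m c k = 1 := by
  rw [mul_classEmb]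
  ext x y
  simp [classEmb, Matrix.one_apply, (classIncl_injective c k).eq_iff]

variable [DecidableEq κ]

/-- A matrix whose rows outside class `k` vanish factors through the inclusion of class `k`. -/
theorem eq_classEmb_mul_of_rows {l : Type*} {N : Matrix (Σ i, m i) l F} {c : ι → κ} {k : κ}
    (h : ∀ a b, c a.1 ≠ k → N a b = 0) :
    N = classEmb F m c k * N.submatrix (classIncl m c k) id := by
  ext a b
  rw [Matrix.mul_apply]
  by_cases ha : c a.1 = k
  · obtain ⟨x, rfl⟩ := exists_classIncl_eq ha
    rw [Finset.sum_eq_single x]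
    · rw [classEmb, submatrix_apply, id, Matrix.one_apply_eq, one_mul, submatrix_apply, id]
    · intro y _ hy
      simp [classEmb, (classIncl_injective c k).ne hy.symm]
    · simp
  · rw [h a b ha, eq_comm]
    refine Finset.sum_eq_zero fun x _ => ?_
    have : a ≠ classIncl m c k x := by
      rintro rfl
      exact ha x.1.2
    simp [classEmb, this]

theorem blockDiagonal'_mul_classEmb (M : ∀ i, Matrix (m i) (m i) F) (c : ι → κ) (k : κ) :
    blockDiagonal' M * classEmb F m c k = classEmb F m c k * classBlock M c k := by
  rw [mul_classEmb, eq_classEmb_mul_of_rows (c := c) (k := k)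
    (N := (blockDiagonal' M).submatrix id (classIncl m c k))]
  · congr 1
    ext x y
    exact blockDiagonal'_apply_classIncl M c k x y
  · intro a b ha
    rw [submatrix_apply]
    refine blockDiagonal'_apply_eq_zero_of_class_ne M (c := c) ?_
    rwa [show c (classIncl m c k b).1 = k from b.1.2]

end Classes

/-! ### The block form -/

section CanonicalForm

variable {F : Type*} [Field F]

theorem isUnit_blockDiagonal' {ι : Type*} [Fintype ι] [DecidableEq ι] {m : ι → Type*}
    [∀ i, Fintype (m i)] [∀ i, DecidableEq (m i)] {M : ∀ i, Matrix (m i) (m i) F}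
    (h : ∀ i, IsUnit (M i)) : IsUnit (blockDiagonal' M) := by
  choose V hV hV' using fun i => isUnit_iff_exists.1 (h i)
  refine isUnit_iff_exists.2 ⟨blockDiagonal' V, ?_, ?_⟩
  · rw [← blockDiagonal'_mul, ← blockDiagonal'_one]
    exact congrArg _ (funext hV)
  · rw [← blockDiagonal'_mul, ← blockDiagonal'_one]
    exact congrArg _ (funext hV')

/-- The four kinds of primary components `F[X] / (p ^ e)`: nilpotent (or zero) ones get class `0`,
and even `p` class `3`. The other `p` come in pairs `p`, `± p(-x)`, whose members get the classes
`1` and `2` in the order given by a well-ordering of `F[X]`. -/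
noncomputable def primaryClass (p : F[X]) (e : ℕ) : Fin 4 :=
  open Classical in
  if p = X ∨ e = 0 then 0
  else if negArg p = p then 3
  else if WellOrderingRel p (negArg p) then 1
  else 2

theorem eq_X_or_of_primaryClass_eq_zero {p : F[X]} {e : ℕ} (h : primaryClass p e = 0) :
    p = X ∨ e = 0 := by
  unfold primaryClass at h
  split_ifs at h with h1
  all_goals first | exact h1 | exact absurd h (by decide)

theorem ne_X_of_primaryClass_ne_zero {p : F[X]} {e : ℕ} (h : primaryClass p e ≠ 0) :
    p ≠ X ∧ e ≠ 0 := by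
  unfold primaryClass at h
  split_ifs at h with h1
  all_goals first | exact not_or.1 h1 | exact absurd rfl h

theorem negArg_eq_of_primaryClass_eq_three {p : F[X]} {e : ℕ} (h : primaryClass p e = 3) :
    negArg p = p := by
  unfold primaryClass at h
  split_ifs at h with h1 h2
  all_goals first | exact h2 | exact absurd h (by decide)

theorem negArg_eq_X_iff {p : F[X]} : negArg p = X ↔ p = X :=
  ⟨fun h => by rw [← negArg_negArg p, h, negArg_X], fun h => by rw [h, negArg_X]⟩

theorem primaryClass_negArg_of_eq_one {p : F[X]} {e e' : ℕ} (h : primaryClass p e = 1)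
    (he' : e' ≠ 0) : primaryClass (negArg p) e' = 2 := by
  unfold primaryClass at h
  split_ifs at h with h1 h2 h3
  all_goals try exact absurd h (by decide)
  have h4 : ¬ WellOrderingRel (negArg p) p := fun h4 => asymm_of WellOrderingRel h3 h4
  rw [primaryClass, if_neg (by rw [negArg_eq_X_iff]; tauto), negArg_negArg,
    if_neg (fun h => h2 h.symm), if_neg h4]

theorem primaryClass_negArg_of_eq_two {p : F[X]} {e e' : ℕ} (h : primaryClass p e = 2)
    (he' : e' ≠ 0) : primaryClass (negArg p) e' = 1 := by
  unfold primaryClass at h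
  split_ifs at h with h1 h2 h3
  all_goals try exact absurd h (by decide)
  have h4 : WellOrderingRel (negArg p) p := by
    rcases trichotomous_of WellOrderingRel p (negArg p) with h | h | h
    exacts [absurd h h3, absurd h.symm h2, h]
  rw [primaryClass, if_neg (by rw [negArg_eq_X_iff]; tauto), negArg_negArg,
    if_neg (fun h => h2 h.symm), if_pos h4]

variable {ι : Type*} [Fintype ι] [DecidableEq ι] {p : ι → F[X]} {e : ι → ℕ}

/-- The block of `D` between two primary components vanishes unless their polynomials are
exchanged by `p ↦ ± p(-x)`. -/
theorem eq_negArg_of_apply_ne_zero (hp : ∀ i, (p i).Monic ∧ Irreducible (p i))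
    {D : Matrix (Σ i, Fin (p i ^ e i).natDegree) (Σ i, Fin (p i ^ e i).natDegree) F}
    (hD : D * blockDiagonal' (fun i => companion (p i ^ e i)) =
      -(blockDiagonal' (fun i => companion (p i ^ e i)) * D))
    {a b : Σ i, Fin (p i ^ e i).natDegree} (hab : D a b ≠ 0) :
    p a.1 = negArg (p b.1) ∧ e a.1 ≠ 0 := by
  obtain ⟨i, x⟩ := a
  obtain ⟨j, y⟩ := b
  have hblock : D.submatrix (Sigma.mk i) (Sigma.mk j) * companion (p j ^ e j) =
      -(companion (p i ^ e i) * D.submatrix (Sigma.mk i) (Sigma.mk j)) := by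
    ext x y
    have := congrFun (congrFun hD ⟨i, x⟩) ⟨j, y⟩
    rw [neg_apply, mul_blockDiagonal'_apply, blockDiagonal'_mul_apply] at this
    rw [neg_apply, Matrix.mul_apply, Matrix.mul_apply]
    exact this
  refine ⟨?_, fun h0 => ?_⟩
  · refine eq_negArg_of_not_isCoprime (hp j).1 (hp j).2 (hp i).1 (hp i).2 fun hco => hab ?_
    have hz := eq_zero_of_mul_companion_eq_neg ((hp j).1.pow _) ((hp i).1.pow _)
      (by rw [pow_comp]; exact hco.pow) hblock
    exact congrFun (congrFun hz x) y
  · have hdeg : (p i ^ e i).natDegree = 0 := by rw [show e i = 0 from h0, pow_zero, natDegree_one]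
    exact Nat.not_lt_zero _ (hdeg ▸ x.2 : (x : ℕ) < 0)

/-- On the components of class `1` the matrix is invertible, and `D` identifies the components of
class `2` with them up to a sign. -/
theorem classBlock_two_isSimilar_neg (hp : ∀ i, (p i).Monic ∧ Irreducible (p i))
    {D : Matrix (Σ i, Fin (p i ^ e i).natDegree) (Σ i, Fin (p i ^ e i).natDegree) F}
    (hD : D * blockDiagonal' (fun i => companion (p i ^ e i)) =
      -(blockDiagonal' (fun i => companion (p i ^ e i)) * D))
    (hker : ∀ v, D *ᵥ v = 0 → (blockDiagonal' (fun i => companion (p i ^ e i)) ^ 2) *ᵥ v = 0)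
    {c : ι → Fin 4} (hc : ∀ i, c i = primaryClass (p i) (e i)) :
    (IsUnit (classBlock (fun i => companion (p i ^ e i)) c 1)) ∧
    IsSimilar (classBlock (fun i => companion (p i ^ e i)) c 2)
      (-(classBlock (fun i => companion (p i ^ e i)) c 1)) := by
  have hunit : ∀ k ≠ 0, IsUnit (classBlock (fun i => companion (p i ^ e i)) c k) := by
    intro k hk
    refine isUnit_blockDiagonal' fun i => isUnit_companion ((hp i).1.pow _) ?_
    have hX := (ne_X_of_primaryClass_ne_zero (by rw [← hc, i.2]; exact hk)).1
    refine IsCoprime.pow_right (irreducible_X.coprime_iff_not_dvd.2 fun h => hX ?_)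
    exact (eq_of_monic_of_associated monic_X (hp i).1
      (irreducible_X.associated_of_dvd (hp i).2 h)).symm
  have hswap : ∀ k l : Fin 4, (∀ q d d', primaryClass (F := F) q d = k → d' ≠ 0 →
      primaryClass (negArg q) d' = l) →
      D * classEmb F (fun i => Fin (p i ^ e i).natDegree) c k =
        classEmb F (fun i => Fin (p i ^ e i).natDegree) c l *
          D.submatrix (classIncl _ c l) (classIncl _ c k) := by
    intro k l h
    rw [mul_classEmb]
    refine eq_classEmb_mul_of_rows fun a b hab => ?_
    by_contra hne
    rw [submatrix_apply, id] at hne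
    obtain ⟨h1, h2⟩ := eq_negArg_of_apply_ne_zero hp hD hne
    refine hab ?_
    rw [hc, h1]
    exact h _ _ _ ((hc _).symm.trans b.1.2) h2
  exact ⟨hunit 1 (by decide), isSimilar_neg_of_swap hD hker (transpose_classEmb_mul_self c 1)
    (transpose_classEmb_mul_self c 2) (blockDiagonal'_mul_classEmb _ c 1)
    (blockDiagonal'_mul_classEmb _ c 2) (hunit 1 (by decide)) (hunit 2 (by decide))
    (hswap 1 2 fun _ _ _ => primaryClass_negArg_of_eq_one)
    (hswap 2 1 fun _ _ _ => primaryClass_negArg_of_eq_two)⟩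

theorem isNilpotent_classBlock_zero (hp : ∀ i, (p i).Monic ∧ Irreducible (p i))
    {c : ι → Fin 4} (hc : ∀ i, c i = primaryClass (p i) (e i)) :
    IsNilpotent (classBlock (fun i => companion (p i ^ e i)) c 0) := by
  refine ⟨∑ i, e i, ?_⟩
  rw [classBlock, ← blockDiagonal'_pow, ← blockDiagonal'_zero]
  congr 1
  funext i
  have hdvd : p i ^ e i ∣ X ^ ∑ i, e i := by
    rcases eq_X_or_of_primaryClass_eq_zero ((hc i).symm.trans i.2) with h | h
    · rw [h]
      exact pow_dvd_pow _ (Finset.single_le_sum (fun _ _ => Nat.zero_le _) (Finset.mem_univ i.1))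
    · rw [h, pow_zero]
      exact one_dvd _
  have := (aeval_companion_eq_zero_iff ((hp i).1.pow _) _).2 hdvd
  rwa [map_pow, aeval_X] at this

theorem isSimilar_blockDiagonal'_reindex {ι' : Type*} [Fintype ι'] [DecidableEq ι']
    {m : ι → Type*} [∀ i, Fintype (m i)] [∀ i, DecidableEq (m i)]
    (M : ∀ i, Matrix (m i) (m i) F) (f : ι' ≃ ι) :
    IsSimilar (blockDiagonal' M) (blockDiagonal' fun i => M (f i)) := by
  convert isSimilar_submatrix (blockDiagonal' M) (Equiv.sigmaCongrLeft (β := m) f) using 1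
  ext ⟨i, x⟩ ⟨j, y⟩
  rw [submatrix_apply]
  by_cases h : i = j
  · subst h
    rw [blockDiagonal'_apply_eq]
    exact (blockDiagonal'_apply_eq M (f i) x y).symm
  · rw [blockDiagonal'_apply_ne _ _ _ h]
    exact (blockDiagonal'_apply_ne M x y fun h' => h (f.injective h')).symm

theorem isEvenPrimaryForm_of_isSimilar_classBlock_three (h2 : (2 : F) ≠ 0)
    (hp : ∀ i, (p i).Monic ∧ Irreducible (p i))
    {c : ι → Fin 4} (hc : ∀ i, c i = primaryClass (p i) (e i))
    {m : Type*} [Fintype m] [DecidableEq m] {C : Matrix m m F}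
    (hC : IsSimilar C (classBlock (fun i => companion (p i ^ e i)) c 3)) :
    IsEvenPrimaryForm C := by
  let f := (Fintype.equivFin {i // c i = 3}).symm
  refine ⟨_, fun i => p (f i), fun i => e (f i), fun i => ?_,
    hC.trans (isSimilar_blockDiagonal'_reindex
      (fun i : {i // c i = 3} => companion (p i ^ e i)) f)⟩
  have hi : primaryClass (p (f i)) (e (f i)) = 3 := (hc _).symm.trans (f i).2
  obtain ⟨hX, he⟩ := ne_X_of_primaryClass_ne_zero (by rw [hi]; decide)
  have h0 := coeff_zero_ne_zero (hp (f i)).1 (hp (f i)).2 hX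
  exact ⟨(hp _).1, (hp _).2,
    isEvenPoly_of_negArg_eq h2 h0 (negArg_eq_of_primaryClass_eq_three hi), h0,
    Nat.one_le_iff_ne_zero.2 he⟩

-- Instances on the nested sums of index types exceed the default size bound.
set_option synthInstance.maxSize 1024 in
/-- The block form exists as soon as some `D` anticommutes with `A` and kills only vectors killed by
`A ^ 2`: outside the nilpotent part, such a `D` exchanges the primary components of `A` for `p` and
`± p(-x)`. -/
theorem exists_isSimilar_dg_of_anticommute (h2 : (2 : F) ≠ 0) {n : Type*} [Fintype n]
    [DecidableEq n] {A D : Matrix n n F} (hD : D * A = -(A * D))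
    (hker : ∀ v, D *ᵥ v = 0 → (A ^ 2) *ᵥ v = 0) :
    ∃ (k l m : ℕ) (N : Matrix (Fin k) (Fin k) F) (X : Matrix (Fin l) (Fin l) F)
        (C : Matrix (Fin m) (Fin m) F),
      IsNilpotent N ∧ IsUnit X ∧ IsEvenPrimaryForm C ∧
        IsSimilar A (dg N (dg X (dg (-X) C))) := by
  obtain ⟨ι, _, _, p, e, hp, hA⟩ := exists_isSimilar_blockDiagonal_companion A
  -- Conjugation transports `D` to the block diagonal form of `A`.
  obtain ⟨D', hD', hker'⟩ : ∃ D',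
      D' * blockDiagonal' (fun i => companion (p i ^ e i)) =
        -(blockDiagonal' (fun i => companion (p i ^ e i)) * D') ∧
      ∀ v, D' *ᵥ v = 0 →
        (blockDiagonal' (fun i => companion (p i ^ e i)) ^ 2) *ᵥ v = 0 := by
    obtain ⟨P, Q, hPQ, hQP, hB⟩ := hA
    have hmul : ∀ Y Z : Matrix n n F, Q * Y * P * (Q * Z * P) = Q * (Y * Z) * P := by
      intro Y Z
      calc Q * Y * P * (Q * Z * P) = Q * Y * (P * Q) * Z * P := by simp only [Matrix.mul_assoc]
        _ = _ := by rw [hPQ, Matrix.mul_one]; simp only [Matrix.mul_assoc]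
    rw [hB]
    refine ⟨Q * D * P, ?_, fun v hv => ?_⟩
    · rw [hmul, hmul, hD, Matrix.mul_neg, Matrix.neg_mul]
    · have h1 : D *ᵥ (P *ᵥ v) = 0 := by
        have := congrArg (P *ᵥ ·) hv
        simpa only [mulVec_mulVec, ← Matrix.mul_assoc, hPQ, Matrix.one_mul, mulVec_zero]
          using this
      have h2 := congrArg (Q *ᵥ ·) (hker _ h1)
      rw [pow_two, hmul, ← pow_two]
      simpa only [mulVec_mulVec, mulVec_zero, Matrix.mul_assoc] using h2
  let c : ι → Fin 4 := fun i => primaryClass (p i) (e i)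
  have hc : ∀ i, c i = primaryClass (p i) (e i) := fun _ => rfl
  let B : ∀ k, Matrix _ _ F := classBlock (fun i => companion (p i ^ e i)) c
  have hfin : ∀ k, ∃ (d : ℕ) (Y : Matrix (Fin d) (Fin d) F), IsSimilar (B k) Y := fun k =>
    ⟨_, _, isSimilar_submatrix (B k) (Fintype.equivFin _).symm⟩
  obtain ⟨k, N, hN⟩ := hfin 0
  obtain ⟨l, X, hX⟩ := hfin 1
  obtain ⟨m, C, hC⟩ := hfin 3
  obtain ⟨hunit, hneg⟩ := classBlock_two_isSimilar_neg hp hD' hker' hc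
  exact ⟨k, l, m, N, X, C, hN.isNilpotent (isNilpotent_classBlock_zero hp hc), hX.isUnit hunit,
    isEvenPrimaryForm_of_isSimilar_classBlock_three h2 hp hc hC.symm,
    (hA.trans (blockDiagonal'_isSimilar_dg _ c)).trans
      (hN.dg (hX.dg ((hneg.trans hX.neg).dg hC)))⟩

end CanonicalForm

/-! ### Relations between the four conditions -/

section Criterion

variable {F : Type*} [Field F] {n : Type*} [Fintype n] [DecidableEq n]

/-- With `e = (1 + V) / 2` the projection attached to the involution `V`, the summands `A e` and
`A (1 - e)` are square-zero, since `e A = A (1 - e)`. -/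
theorem HasSkewInvolution.exists_isSquareZero_add (h2 : (2 : F) ≠ 0) {A : Matrix n n F}
    (h : HasSkewInvolution A) :
    ∃ S T : Matrix n n F, IsSquareZero S ∧ IsSquareZero T ∧ A = S + T := by
  obtain ⟨V, hV, hAV⟩ := h
  rw [IsInvolution, pow_two] at hV
  have hVA : V * A = -(A * V) := by rw [hAV, neg_neg]
  have hz : (A * (1 + V)) * (A * (1 + V)) = 0 := by
    calc (A * (1 + V)) * (A * (1 + V)) = A * (A + V * A) * (1 + V) := by noncomm_ring
      _ = A * A * (1 - V * V) := by rw [hVA]; noncomm_ring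
      _ = 0 := by rw [hV, sub_self, Matrix.mul_zero]
  have hz' : (A * (1 - V)) * (A * (1 - V)) = 0 := by
    calc (A * (1 - V)) * (A * (1 - V)) = A * (A - V * A) * (1 - V) := by noncomm_ring
      _ = A * A * (1 - V * V) := by rw [hVA]; noncomm_ring
      _ = 0 := by rw [hV, sub_self, Matrix.mul_zero]
  refine ⟨(2⁻¹ : F) • (A * (1 + V)), (2⁻¹ : F) • (A * (1 - V)), ?_, ?_, ?_⟩
  · rw [IsSquareZero, _root_.smul_pow, pow_two (A * _), hz, smul_zero]
  · rw [IsSquareZero, _root_.smul_pow, pow_two (A * _), hz', smul_zero]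
  · rw [← smul_add, ← Matrix.mul_add, add_add_sub_cancel, ← two_smul F (1 : Matrix n n F),
      Matrix.mul_smul, smul_smul, inv_mul_cancel₀ h2, one_smul, Matrix.mul_one]

theorem HasSkewInvolution.isSimilar_neg {A : Matrix n n F} (h : HasSkewInvolution A) :
    IsSimilar A (-A) := by
  obtain ⟨V, hV, hAV⟩ := h
  rw [IsInvolution, pow_two] at hV
  refine ⟨V, V, hV, hV, ?_⟩
  rw [Matrix.mul_assoc, hAV, Matrix.mul_neg, ← Matrix.mul_assoc, hV, Matrix.one_mul]

/-- For square-zero `S` and `T`, the difference `D = S - T` anticommutes with `A = S + T`, and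
`D ^ 2 = -A ^ 2`, so `D` kills only vectors killed by `A ^ 2`. -/
theorem exists_anticommute_of_isSquareZero_add {S T : Matrix n n F} (hS : IsSquareZero S)
    (hT : IsSquareZero T) :
    ∃ D, D * (S + T) = -((S + T) * D) ∧ ∀ v, D *ᵥ v = 0 → ((S + T) ^ 2) *ᵥ v = 0 := by
  rw [IsSquareZero, pow_two] at hS hT
  refine ⟨S - T, ?_, fun v hv => ?_⟩
  · simp only [Matrix.sub_mul, Matrix.mul_add, Matrix.add_mul, Matrix.mul_sub, hS, hT]
    abel
  · have h : (S + T) ^ 2 = -((S - T) * (S - T)) := by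
      simp only [pow_two, Matrix.sub_mul, Matrix.mul_add, Matrix.add_mul, Matrix.mul_sub, hS, hT]
      abel
    rw [h, neg_mulVec, ← mulVec_mulVec, hv, mulVec_zero, neg_zero]

theorem IsSimilar.exists_anticommute {A : Matrix n n F} (h : IsSimilar A (-A)) :
    ∃ D, D * A = -(A * D) ∧ ∀ v, D *ᵥ v = 0 → (A ^ 2) *ᵥ v = 0 := by
  obtain ⟨P, Q, hPQ, hQP, hA⟩ := h
  refine ⟨P, ?_, fun v hv => ?_⟩
  · rw [← neg_eq_iff_eq_neg, ← Matrix.mul_neg, hA, ← Matrix.mul_assoc, ← Matrix.mul_assoc, hPQ,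
      Matrix.one_mul]
  · have hv0 : v = 0 := by rw [← one_mulVec v, ← hQP, ← mulVec_mulVec, hv, mulVec_zero]
    rw [hv0, mulVec_zero]

theorem hasSkewInvolution_of_isSimilar_dg {k l m : ℕ} {A : Matrix n n F}
    {N : Matrix (Fin k) (Fin k) F} {X : Matrix (Fin l) (Fin l) F} {C : Matrix (Fin m) (Fin m) F}
    (hN : IsNilpotent N) (hC : IsEvenPrimaryForm C)
    (hA : IsSimilar A (dg N (dg X (dg (-X) C)))) : HasSkewInvolution A := by
  have h : IsSimilar (dg (dg X (-X)) C) (dg X (dg (-X) C)) := by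
    convert isSimilar_submatrix (dg (dg X (-X)) C) (Equiv.sumAssoc _ _ _).symm using 1
    ext (i | i | i) (j | j | j) <;> rfl
  exact ((hasSkewInvolution_of_isNilpotent hN).dg
    (((hasSkewInvolution_dg_neg X).dg hC.hasSkewInvolution).of_isSimilar h)).of_isSimilar hA.symm

end Criterion

end SquareZeroSums


theorem mainTheorem8 {F : Type*} [Field F] (hF : ringChar F ≠ 2) (n : ℕ)
    (A : Matrix (Fin n) (Fin n) F) :
    List.TFAE [
      ∃ S T : Matrix (Fin n) (Fin n) F,
        SquareZeroSums.IsSquareZero S ∧ SquareZeroSums.IsSquareZero T ∧ A = S + T,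
      SquareZeroSums.IsSimilar A (-A),
      ∃ V : Matrix (Fin n) (Fin n) F, SquareZeroSums.IsInvolution V ∧ A * V = -(V * A),
      ∃ (k l m : ℕ) (N : Matrix (Fin k) (Fin k) F) (X : Matrix (Fin l) (Fin l) F)
        (C : Matrix (Fin m) (Fin m) F),
        IsNilpotent N ∧ IsUnit X ∧ SquareZeroSums.IsEvenPrimaryForm C ∧
          SquareZeroSums.IsSimilar A
            (SquareZeroSums.dg N (SquareZeroSums.dg X (SquareZeroSums.dg (-X) C)))] := by
  have h2 : (2 : F) ≠ 0 := Ring.two_ne_zero hF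
  tfae_have 1 → 4 := by
    rintro ⟨S, T, hS, hT, rfl⟩
    obtain ⟨D, hD, hker⟩ := SquareZeroSums.exists_anticommute_of_isSquareZero_add hS hT
    exact SquareZeroSums.exists_isSimilar_dg_of_anticommute h2 hD hker
  tfae_have 2 → 4 := by
    intro h
    obtain ⟨D, hD, hker⟩ := h.exists_anticommute
    exact SquareZeroSums.exists_isSimilar_dg_of_anticommute h2 hD hker
  tfae_have 4 → 3 := by
    rintro ⟨k, l, m, N, X, C, hN, -, hC, hA⟩
    exact SquareZeroSums.hasSkewInvolution_of_isSimilar_dg hN hC hA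
  tfae_have 3 → 1 := fun h => SquareZeroSums.HasSkewInvolution.exists_isSquareZero_add h2 h
  tfae_have 3 → 2 := fun h => SquareZeroSums.HasSkewInvolution.isSimilar_neg h
  tfae_finish
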